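/- Let $N\ge 2$, let $\mu$ be the normalized Haar measure on the circle group $\mathbb T$, and let $m_0\in L^\infty(\mathbb T)$ be non-singular, i.e. $m_0\neq 0$ $\mu$-almost everywhere (no normalization of $m_0$ is needed; in particular $m_0$ may be any non-singular wavelet filter of order $N$). Let $$ (Rf)(z)=\frac1N\sum_{w^N=z}|m_0(w)|^2 f(w) $$ be the Ruelle operator, and let $h\in L^1(\mathbb T)$, $h\ge 0$, satisfy $R h=h$ almost everywhere. Let $K_N$ be the compact Pontryagin dual of the discrete group $\Lambda_N=\mathbb Z[\tfrac1N]$. There is a unique finite positive Borel measure $\nu=\nu(m_0,h)$ on $K_N$ such that $$ \int_{K_N} f\bigl(\chi(N^{-i})\bigr)\,d\nu(\chi)=\int_{\mathbb T}R^i(fh)\,d\mu \qquad\text{for all } i=0,1,2,\dots,\ f\in C(\mathbb T). $$ For this measure the following holds. 1. $(S_0\xi)(z)=m_0(z)\,\xi(z^N)$ defines a linear isometry $S_0$ of $L^2(h):=L^2(\mathbb T,h\,d\mu)$ into itself. 2. $(W\xi)(\chi)=\xi(\chi(1))$ defines a linear isometry $W$ of $L^2(h)$ into $L^2(K_N,\nu)$.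 3. The formulas $$ (\pi_\nu(f)\psi)(\chi)=f(\chi(1))\,\psi(\chi)\quad (f\in C(\mathbb T)),\qquad (\pi_\nu(U)\psi)(\chi)=m_0(\chi(1))\,\psi(\chi^N) $$ for $\psi\in L^2(K_N,\nu)$ define a representation $\pi_\nu$ on $L^2(K_N,\nu)$ of the $C^*$-algebra $\mathfrak A_N$ generated by $C(\mathbb T)$ and a unitary $U$ with $UfU^{-1}=f(z^N)$; that is, $f\mapsto\pi_\nu(f)$ is a unital $*$-representation of $C(\mathbb T)$, $\pi_\nu(U)$ is a unitary operator of $L^2(K_N,\nu)$ onto itself, and $\pi_\nu(U)\pi_\nu(f)=\pi_\nu(f(z^N))\,\pi_\nu(U)$. 4. The unitary $\pi_\nu(U)$ is an extension of $S_0$, i.e. $\pi_\nu(U)W=WS_0$, and a power dilation of $S_0$, i.e. $W^*\pi_\nu(U)^nW=S_0^n$ for all $n=0,1,2,\dots$. -/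

import Mathlib

open MeasureTheory Filter
open scoped ENNReal

/-! ### The circle group `𝕋` and its normalized Haar measure -/

noncomputable instance instMeasurableSpaceCircleBorel : MeasurableSpace Circle := borel Circle

instance instBorelSpaceCircle : BorelSpace Circle := ⟨rfl⟩

/-- The Haar measure `μ` on the circle group, normalized by `μ(𝕋) = 1`. -/
noncomputable def circleHaar : Measure Circle := Measure.haarMeasure ⊤

/-- The map `z ↦ z ^ N` on the circle. -/
noncomputable def circlePow (N : ℕ) : C(Circle, Circle) := ⟨fun z => z ^ N, continuous_pow N⟩

/-- The Ruelle operator `(R f)(z) = (1/N) ∑_{w ^ N = z} |m₀(w)|² f(w)`; for `N ≥ 1` the sum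
runs over the `N` roots of `z`. -/
noncomputable def ruelleOp (N : ℕ) (m₀ : Circle → ℂ) (f : Circle → ℂ) (z : Circle) : ℂ :=
  (1 / (N : ℂ)) * ∑ᶠ w ∈ {w : Circle | w ^ N = z}, ((‖m₀ w‖ ^ 2 : ℝ) : ℂ) * f w

/-- A function on the circle is non-singular if its zero set has Haar measure zero. -/
def NonSingular (m₀ : Circle → ℂ) : Prop := ∀ᵐ z ∂circleHaar, m₀ z ≠ 0

/-- The measure `h dμ` on the circle. -/
noncomputable def weightedHaar (h : Circle → ℝ) : Measure Circle :=
  circleHaar.withDensity fun z => ENNReal.ofReal (h z)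

/-! ### The discrete group `Λ_N = ℤ[1/N]` and its compact dual `K_N` -/

/-- The ring `Λ_N = ℤ[1/N]`, as the subring of `ℚ` generated by `1/N`. It is given the discrete
topology below, not the topology induced from `ℚ`. -/
def LambdaN (N : ℕ) : Type := Algebra.adjoin ℤ ({(N : ℚ)⁻¹} : Set ℚ)

noncomputable instance (N : ℕ) : CommRing (LambdaN N) :=
  inferInstanceAs (CommRing (Algebra.adjoin ℤ ({(N : ℚ)⁻¹} : Set ℚ)))

instance (N : ℕ) : TopologicalSpace (LambdaN N) := ⊥

instance (N : ℕ) : DiscreteTopology (LambdaN N) := ⟨rfl⟩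

/-- The element `1 / N ^ k` of `Λ_N`. -/
noncomputable def invPow (N k : ℕ) : LambdaN N :=
  ⟨((N : ℚ)⁻¹) ^ k, pow_mem (Algebra.subset_adjoin (Set.mem_singleton _)) k⟩

/-- The compact group `K_N`, the Pontryagin dual of the discrete group `Λ_N`. -/
abbrev KN (N : ℕ) : Type := PontryaginDual (Multiplicative (LambdaN N))

noncomputable instance (N : ℕ) : MeasurableSpace (KN N) := borel (KN N)

instance (N : ℕ) : BorelSpace (KN N) := ⟨rfl⟩

/-- The coordinate `χ ↦ χ(1 / N ^ k)` on `K_N`. A function `f` on the circle defines the function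
`χ ↦ f (χ(1 / N ^ k))` on `K_N`, which is the Gelfand transform of `U ^ (-k) f U ^ k`; for
`f(z) = z ^ n` it is `e(n / N ^ k)`. -/
noncomputable def KN.coord {N : ℕ} (k : ℕ) (χ : KN N) : Circle :=
  χ (Multiplicative.ofAdd (invPow N k))

/-- `ν` is the measure `ν(m₀, h)`: a finite positive Borel measure on `K_N` with
`∫ U ^ (-i) f U ^ i dν = ∫ R ^ i (f h) dμ` for all `i ≥ 0` and all continuous `f` on the circle. -/
structure IsHarmonicMeasure (N : ℕ) (m₀ : Circle → ℂ) (h : Circle → ℝ)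
    (ν : Measure (KN N)) : Prop where
  finite : IsFiniteMeasure ν
  integral_eq : ∀ (i : ℕ) (f : C(Circle, ℂ)),
    ∫ χ, f (χ.coord i) ∂ν =
      ∫ z, (ruelleOp N m₀)^[i] (fun w => f w * (h w : ℂ)) z ∂circleHaar

/-! ### Operators and representations -/

/-- The map `T` between `L²`-spaces is given by `(T f)(y) = w(y) f(τ(y))` for almost all `y`,
whichever representative `f` of an element of `L²` is used. -/
def IsWeightedComp {X Y : Type*} [MeasurableSpace X] [MeasurableSpace Y] {α : Measure X}
    {β : Measure Y} (T : Lp ℂ 2 α → Lp ℂ 2 β) (w : Y → ℂ) (τ : Y → X) : Prop :=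
  ∀ (f : X → ℂ) (hf : MemLp f 2 α), T (hf.toLp f) =ᵐ[β] fun y => w y * f (τ y)

/-- A representation on `H` of the C*-algebra `𝔄_N` on the generators `C(𝕋)` and a unitary `U`
with the relation `U f U⁻¹ = f(z ^ N)`: a unital *-representation `π` of `C(𝕋)` and a unitary
operator `U` on `H` with `U π(f) = π(f(z ^ N)) U`. -/
structure RepAN (N : ℕ) (H : Type*) [NormedAddCommGroup H] [InnerProductSpace ℂ H]
    [CompleteSpace H] where
  π : C(Circle, ℂ) →⋆ₐ[ℂ] (H →L[ℂ] H)
  U : H ≃ₗᵢ[ℂ] H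
  covariant : ∀ (f : C(Circle, ℂ)) (x : H), U (π f x) = π (f.comp (circlePow N)) (U x)

/-!
Write `m⁽ⁱ⁾(z) = m₀(z) m₀(z ^ N) ⋯ m₀(z ^ (N ^ (i - 1)))` (`filterProd`). Averaging over the fibres of
`z ↦ z ^ N` preserves Haar integrals, so `∫ R g dμ = ∫ |m₀|² g dμ`; together with
`R(f(z ^ N) g) = f R(g)` this gives `∫ Rⁱ(f h) dμ = ∫ f |m⁽ⁱ⁾|² h dμ`
(`integral_ruelleOp_iterate`). Hence `ν` is the required measure exactly when, for every `i`, the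
coordinate `χ ↦ χ(N ^ (-i))` has the law `νᵢ = |m⁽ⁱ⁾|² h dμ` (`isHarmonicMeasure_iff`).

The fixed point equation `R h = h` says that `z ↦ z ^ N` carries `νᵢ₊₁` to `νᵢ`
(`measurePreserving_pow_towerMeasure`). A finite measure on `K_N` is determined by the laws of the
coordinates, since these generate the Borel sets and each is a function of the next
(`KN.measure_ext`). For existence, the characters `x ↦ exp (i t x)` with `t` real provide a
measurable section of the `i`-th coordinate; the image of `νᵢ` under it has the right laws in the
coordinates up to `i`, and a limit point of these images, in the compact space of measures on `K_N`
of bounded mass, has the right laws in all coordinates (`exists_isHarmonicMeasure`).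

If `τ` carries `|w|² dβ` to `α`, then `f ↦ w · (f ∘ τ)` is an isometry from `L²(α)` to `L²(β)`
(`weightedComp`). The operators `S₀`, `W` and `π_ν(U)` are of this form. For `S₀` the hypothesis is
the consistency of `ν₁` and `ν₀`, for `W` it is the law of the coordinate `χ(1)`, and for `π_ν(U)`
it is the identity `(χ ↦ χ ^ N)_* (|m₀(χ(1))|² dν) = ν`, which follows from
`|m⁽ⁱ⁺¹⁾(z)|² = |m⁽ⁱ⁾(z)|² |m₀(z ^ (N ^ i))|²` by uniqueness
(`IsHarmonicMeasure.measurePreserving_pow`). Multiplication by `N` on `ℤ[1/N]` is invertible, so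
`χ ↦ χ ^ N` is a homeomorphism of `K_N`, and `π_ν(U)` is onto because `m₀(χ(1)) ≠ 0` for `ν`-almost
all `χ`.
-/

/-! ### Weighted composition operators between `L²`-spaces -/

section WeightedComposition

variable {X Y : Type*} [MeasurableSpace X] [MeasurableSpace Y]

/-- The measure `|w|² dβ`. -/
noncomputable def sqDensity (β : Measure Y) (w : Y → ℂ) : Measure Y :=
  β.withDensity fun y => ‖w y‖ₑ ^ 2

lemma sqDensity_absolutelyContinuous (β : Measure Y) (w : Y → ℂ) : sqDensity β w ≪ β :=
  withDensity_absolutelyContinuous _ _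

lemma aemeasurable_enorm_sq {β : Measure Y} {w : Y → ℂ} (hw : AEStronglyMeasurable w β) :
    AEMeasurable (fun y => ‖w y‖ₑ ^ 2) β :=
  hw.enorm.pow_const 2

lemma ae_sqDensity_iff {β : Measure Y} {w : Y → ℂ} (hw : AEStronglyMeasurable w β)
    {p : Y → Prop} : (∀ᵐ y ∂sqDensity β w, p y) ↔ ∀ᵐ y ∂β, w y ≠ 0 → p y := by
  rw [sqDensity, ae_withDensity_iff' (aemeasurable_enorm_sq hw)]
  simp

lemma aestronglyMeasurable_mul_of_sqDensity {β : Measure Y} {w g : Y → ℂ}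
    (hw : AEStronglyMeasurable w β) (hg : AEStronglyMeasurable g (sqDensity β w)) :
    AEStronglyMeasurable (fun y => w y * g y) β := by
  refine (hw.mul hg.stronglyMeasurable_mk.aestronglyMeasurable).congr ?_
  filter_upwards [(ae_sqDensity_iff hw).1 hg.ae_eq_mk] with y hy
  by_cases h0 : w y = 0
  · simp [h0]
  · simp [hy h0]

lemma eLpNorm_mul_eq_eLpNorm_sqDensity {β : Measure Y} {w g : Y → ℂ}
    (hw : AEStronglyMeasurable w β) (hg : AEStronglyMeasurable g (sqDensity β w)) :
    eLpNorm (fun y => w y * g y) 2 β = eLpNorm g 2 (sqDensity β w) := by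
  rw [eLpNorm_eq_lintegral_rpow_enorm_toReal two_ne_zero ENNReal.ofNat_ne_top,
    eLpNorm_eq_lintegral_rpow_enorm_toReal two_ne_zero ENNReal.ofNat_ne_top, sqDensity,
    lintegral_withDensity_eq_lintegral_mul₀' (aemeasurable_enorm_sq hw)]
  · simp [enorm_mul, mul_pow]
  · exact hg.enorm.pow_const _

lemma memLp_mul_of_sqDensity {β : Measure Y} {w g : Y → ℂ}
    (hw : AEStronglyMeasurable w β) (hg : MemLp g 2 (sqDensity β w)) :
    MemLp (fun y => w y * g y) 2 β :=
  ⟨aestronglyMeasurable_mul_of_sqDensity hw hg.1, by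
    rw [eLpNorm_mul_eq_eLpNorm_sqDensity hw hg.1]; exact hg.2⟩

lemma weightedComp_ae_congr {α : Measure X} {β : Measure Y} {w : Y → ℂ} {τ : Y → X}
    (hw : AEStronglyMeasurable w β) (hτ : MeasurePreserving τ (sqDensity β w) α)
    {f g : X → ℂ} (hfg : f =ᵐ[α] g) :
    (fun y => w y * f (τ y)) =ᵐ[β] fun y => w y * g (τ y) := by
  filter_upwards [(ae_sqDensity_iff hw).1 (hτ.quasiMeasurePreserving.ae_eq_comp hfg)] with y hy
  by_cases h0 : w y = 0
  · simp [h0]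
  · have := hy h0
    simp only [Function.comp_apply] at this
    rw [this]

lemma memLp_weightedComp {α : Measure X} {β : Measure Y} {w : Y → ℂ} {τ : Y → X}
    (hw : AEStronglyMeasurable w β) (hτ : MeasurePreserving τ (sqDensity β w) α)
    {f : X → ℂ} (hf : MemLp f 2 α) : MemLp (fun y => w y * f (τ y)) 2 β :=
  memLp_mul_of_sqDensity hw (hf.comp_measurePreserving hτ)

/-- The isometry `f ↦ w · (f ∘ τ)` from `L²(α)` to `L²(β)`, where `τ` carries the measure
`|w|² dβ` to `α`. -/
noncomputable def weightedComp {α : Measure X} {β : Measure Y} {w : Y → ℂ} {τ : Y → X}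
    (hw : AEStronglyMeasurable w β) (hτ : MeasurePreserving τ (sqDensity β w) α) :
    Lp ℂ 2 α →ₗᵢ[ℂ] Lp ℂ 2 β where
  toFun f := (memLp_weightedComp hw hτ (Lp.memLp f)).toLp _
  map_add' f g := by
    rw [← MemLp.toLp_add, MemLp.toLp_eq_toLp_iff]
    refine (weightedComp_ae_congr hw hτ (Lp.coeFn_add f g)).trans (.of_forall fun y => ?_)
    simp [mul_add]
  map_smul' c f := by
    rw [RingHom.id_apply, ← MemLp.toLp_const_smul, MemLp.toLp_eq_toLp_iff]
    refine (weightedComp_ae_congr hw hτ (Lp.coeFn_smul c f)).trans (.of_forall fun y => ?_)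
    simp [mul_left_comm]
  norm_map' f := by
    change ‖(memLp_weightedComp hw hτ (Lp.memLp f)).toLp _‖ = ‖f‖
    have hm := (Lp.memLp f).1.comp_measurePreserving hτ
    rw [Lp.norm_toLp, Lp.norm_def]
    exact congrArg _ ((eLpNorm_mul_eq_eLpNorm_sqDensity hw hm).trans
      (eLpNorm_comp_measurePreserving (Lp.memLp f).1 hτ))

lemma isWeightedComp_weightedComp {α : Measure X} {β : Measure Y} {w : Y → ℂ} {τ : Y → X}
    (hw : AEStronglyMeasurable w β) (hτ : MeasurePreserving τ (sqDensity β w) α) :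
    IsWeightedComp (weightedComp hw hτ) w τ := fun _ hf =>
  (memLp_weightedComp hw hτ (Lp.memLp (hf.toLp _))).coeFn_toLp.trans
    (weightedComp_ae_congr hw hτ hf.coeFn_toLp)

/-- A weighted composition operator whose weight vanishes almost nowhere, along an invertible
map, is onto: the preimage of `φ` is `(φ / w) ∘ τ⁻¹`. -/
lemma weightedComp_surjective {α : Measure X} {β : Measure Y} {w : Y → ℂ} (τ : Y ≃ᵐ X)
    (hw : AEStronglyMeasurable w β) (hτ : MeasurePreserving τ (sqDensity β w) α)
    (hw0 : ∀ᵐ y ∂β, w y ≠ 0) : Function.Surjective (weightedComp hw hτ) := by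
  intro φ
  have hg : AEStronglyMeasurable (fun y => φ y / w y) β :=
    ((Lp.memLp φ).1.aemeasurable.div hw.aemeasurable).aestronglyMeasurable
  have hg' := hg.mono_ac (sqDensity_absolutelyContinuous β w)
  have hmul : (fun y => w y * (φ y / w y)) =ᵐ[β] φ := by
    filter_upwards [hw0] with y hy
    field_simp
  have hf : MemLp (fun x => φ (τ.symm x) / w (τ.symm x)) 2 α := by
    rw [← hτ.map_eq, τ.memLp_map_measure_iff]
    have : (fun x => φ (τ.symm x) / w (τ.symm x)) ∘ τ = fun y => φ y / w y := by
      ext y; simp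
    rw [this]
    refine ⟨hg', ?_⟩
    rw [← eLpNorm_mul_eq_eLpNorm_sqDensity hw hg', eLpNorm_congr_ae hmul]
    exact (Lp.memLp φ).2
  refine ⟨hf.toLp _, Lp.ext ?_⟩
  refine (isWeightedComp_weightedComp hw hτ _ hf).trans ?_
  simpa using hmul

lemma IsWeightedComp.apply_ae {α : Measure X} {β : Measure Y} {T : Lp ℂ 2 α → Lp ℂ 2 β}
    {w : Y → ℂ} {τ : Y → X} (hT : IsWeightedComp T w τ) (f : Lp ℂ 2 α) :
    T f =ᵐ[β] fun y => w y * f (τ y) := by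
  simpa only [Lp.toLp_coeFn] using hT f (Lp.memLp f)

/-- Any representative of an element of `L²` may be used to compute its image. -/
lemma IsWeightedComp.apply_ae_of_ae_eq {α : Measure X} {β : Measure Y}
    {T : Lp ℂ 2 α → Lp ℂ 2 β} {w : Y → ℂ} {τ : Y → X} (hT : IsWeightedComp T w τ)
    {f : Lp ℂ 2 α} {g : X → ℂ} (hg : f =ᵐ[α] g) : T f =ᵐ[β] fun y => w y * g (τ y) := by
  have hgm : MemLp g 2 α := (Lp.memLp f).ae_eq hg
  have : f = hgm.toLp g := Lp.ext (hg.trans hgm.coeFn_toLp.symm)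
  rw [this]
  exact hT g hgm

lemma withDensity_map_of_comp {ν : Measure Y} {φ : Y → X} (hφ : Measurable φ) {g : X → ℝ≥0∞}
    (hg : AEMeasurable g (ν.map φ)) :
    (ν.withDensity (g ∘ φ)).map φ = (ν.map φ).withDensity g := by
  ext s hs
  rw [Measure.map_apply hφ hs, withDensity_apply _ (hφ hs), withDensity_apply _ hs,
    Measure.restrict_map hφ hs, lintegral_map' _ hφ.aemeasurable]
  · rfl
  · rw [← Measure.restrict_map hφ hs]
    exact hg.restrict

lemma sqDensity_comp_map {ν : Measure Y} {φ : Y → X} (hφ : Measurable φ) {w : X → ℂ}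
    (hw : AEStronglyMeasurable w (ν.map φ)) :
    (sqDensity ν fun y => w (φ y)).map φ = sqDensity (ν.map φ) w := by
  rw [sqDensity, sqDensity, ← withDensity_map_of_comp hφ (aemeasurable_enorm_sq hw)]
  rfl

lemma sqDensity_one (β : Measure Y) : sqDensity β (fun _ => 1) = β := by
  simp [sqDensity]

lemma sqDensity_sqDensity {β : Measure Y} {w v : Y → ℂ} (hw : AEStronglyMeasurable w β)
    (hv : AEStronglyMeasurable v β) :
    sqDensity (sqDensity β w) v = sqDensity β fun y => w y * v y := by
  rw [sqDensity, sqDensity, sqDensity, ← withDensity_mul₀ (aemeasurable_enorm_sq hw)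
    (aemeasurable_enorm_sq hv)]
  congr 1
  ext y
  simp [enorm_mul, mul_pow]

end WeightedComposition

/-! ### Multiplication by continuous functions as a `*`-representation -/

section Multiplication

variable {X Y : Type*} [TopologicalSpace X] [CompactSpace X] [TopologicalSpace Y]
  [MeasurableSpace Y] [BorelSpace Y] {ν : Measure Y}

lemma memLp_continuous_mul (f : C(X, ℂ)) (κ : C(Y, X)) {g : Y → ℂ} (hg : MemLp g 2 ν) :
    MemLp (fun y => f (κ y) * g y) 2 ν :=
  hg.of_le_mul (c := ‖f‖) ((f.comp κ).continuous.aestronglyMeasurable.mul hg.1)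
    (.of_forall fun y => by
      rw [norm_mul]
      exact mul_le_mul_of_nonneg_right (f.norm_coe_le_norm _) (norm_nonneg _))

/-- The operator on `L²(ν)` of multiplication by `f ∘ κ`. -/
noncomputable def mulComp (κ : C(Y, X)) (f : C(X, ℂ)) : Lp ℂ 2 ν →L[ℂ] Lp ℂ 2 ν :=
  LinearMap.mkContinuous
    { toFun := fun ψ => (memLp_continuous_mul f κ (Lp.memLp ψ)).toLp _
      map_add' := fun φ ψ => by
        rw [← MemLp.toLp_add, MemLp.toLp_eq_toLp_iff]
        filter_upwards [Lp.coeFn_add φ ψ] with y hy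
        rw [hy, Pi.add_apply, Pi.add_apply, mul_add]
      map_smul' := fun c ψ => by
        rw [RingHom.id_apply, ← MemLp.toLp_const_smul, MemLp.toLp_eq_toLp_iff]
        filter_upwards [Lp.coeFn_smul c ψ] with y hy
        simp [hy, mul_left_comm] }
    ‖f‖ fun ψ => by
      refine Lp.norm_le_mul_norm_of_ae_le_mul ?_
      filter_upwards [(memLp_continuous_mul f κ (Lp.memLp ψ)).coeFn_toLp] with y hy
      change ‖((memLp_continuous_mul f κ (Lp.memLp ψ)).toLp _ : Lp ℂ 2 ν) y‖ ≤ _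
      rw [hy, norm_mul]
      exact mul_le_mul_of_nonneg_right (f.norm_coe_le_norm _) (norm_nonneg _)

lemma mulComp_ae (κ : C(Y, X)) (f : C(X, ℂ)) (ψ : Lp ℂ 2 ν) :
    mulComp κ f ψ =ᵐ[ν] fun y => f (κ y) * ψ y :=
  (memLp_continuous_mul f κ (Lp.memLp ψ)).coeFn_toLp

/-- The representation of `C(X)` on `L²(ν)` by multiplication with `f ∘ κ`. -/
noncomputable def mulCompHom (ν : Measure Y) (κ : C(Y, X)) :
    C(X, ℂ) →⋆ₐ[ℂ] (Lp ℂ 2 ν →L[ℂ] Lp ℂ 2 ν) where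
  toFun := mulComp κ
  map_one' := by
    ext1 ψ
    refine Lp.ext ((mulComp_ae κ 1 ψ).trans (.of_forall fun y => ?_))
    simp
  map_mul' f g := by
    ext1 ψ
    refine Lp.ext ?_
    rw [mul_apply_eq_comp]
    filter_upwards [mulComp_ae κ (f * g) ψ, mulComp_ae κ f (mulComp κ g ψ),
      mulComp_ae κ g ψ] with y h1 h2 h3
    simp [h1, h2, h3, mul_assoc]
  map_zero' := by
    ext1 ψ
    refine Lp.ext ?_
    filter_upwards [mulComp_ae κ 0 ψ, Lp.coeFn_zero ℂ 2 ν] with y h1 h2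
    rw [h1, ContinuousMap.zero_apply, zero_mul]
    exact h2.symm
  map_add' f g := by
    ext1 ψ
    refine Lp.ext ?_
    rw [add_apply]
    filter_upwards [mulComp_ae κ (f + g) ψ, mulComp_ae κ f ψ, mulComp_ae κ g ψ,
      Lp.coeFn_add (mulComp κ f ψ) (mulComp κ g ψ)] with y h1 h2 h3 h4
    rw [h1, h4, Pi.add_apply, h2, h3, ContinuousMap.add_apply, add_mul]
  commutes' c := by
    ext1 ψ
    refine Lp.ext ?_
    rw [Algebra.algebraMap_eq_smul_one, Algebra.algebraMap_eq_smul_one,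
      smul_apply, one_apply_eq_self]
    filter_upwards [mulComp_ae κ (c • (1 : C(X, ℂ))) ψ, Lp.coeFn_smul c ψ] with y h1 h2
    simp [h1, h2]
  map_star' f := by
    rw [ContinuousLinearMap.star_eq_adjoint, ContinuousLinearMap.eq_adjoint_iff]
    intro φ ψ
    rw [L2.inner_def, L2.inner_def]
    refine integral_congr_ae ?_
    filter_upwards [mulComp_ae κ (star f) φ, mulComp_ae κ f ψ] with y h1 h2
    rw [h1, h2]
    simp [mul_comm]
    ring

lemma isWeightedComp_mulCompHom (κ : C(Y, X)) (f : C(X, ℂ)) :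
    IsWeightedComp (mulCompHom ν κ f) (fun y => f (κ y)) (fun y => y) := fun g hg => by
  filter_upwards [mulComp_ae κ f (hg.toLp g), hg.coeFn_toLp] with y h1 h2
  rw [← h2]
  exact h1

end Multiplication

/-! ### Haar measure on the circle and `N`-th roots -/

section Roots

instance : circleHaar.IsHaarMeasure := by unfold circleHaar; infer_instance

instance : IsProbabilityMeasure circleHaar := ⟨by
  rw [circleHaar, ← TopologicalSpace.PositiveCompacts.coe_top]
  exact Measure.haarMeasure_self⟩

/-- The `N`-th root of `z` obtained by dividing the principal argument of `z` by `N`. -/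
noncomputable def circleRoot (N : ℕ) (z : Circle) : Circle := Circle.exp (Complex.arg z / N)

/-- The primitive `N`-th root of unity `exp (2πi / N)`. -/
noncomputable def circleZeta (N : ℕ) : Circle := Circle.exp (2 * Real.pi / N)

lemma measurable_circle_arg : Measurable fun z : Circle => Complex.arg z :=
  Complex.measurable_arg.comp (by fun_prop : Continuous fun z : Circle => (z : ℂ)).measurable

lemma measurable_circleRoot (N : ℕ) : Measurable (circleRoot N) :=
  Circle.exp.continuous.measurable.comp (measurable_circle_arg.div_const _)

variable {N : ℕ}

lemma circleExp_div_pow (hN : N ≠ 0) (t : ℝ) : Circle.exp (t / N) ^ N = Circle.exp t := by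
  rw [← Circle.exp_nsmul, nsmul_eq_mul, mul_div_cancel₀]
  exact_mod_cast hN

lemma circleRoot_pow (hN : N ≠ 0) (z : Circle) : circleRoot N z ^ N = z := by
  rw [circleRoot, circleExp_div_pow hN, Circle.exp_arg]

lemma isPrimitiveRoot_circleZeta (hN : N ≠ 0) : IsPrimitiveRoot (circleZeta N) N := by
  have h := Complex.isPrimitiveRoot_exp N hN
  have hc : ((circleZeta N : Circle) : ℂ) = Complex.exp (2 * Real.pi * Complex.I / N) := by
    rw [circleZeta, Circle.coe_exp]
    congr 1
    push_cast
    ring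
  rw [← hc] at h
  exact IsPrimitiveRoot.of_map_of_injective (f := Circle.coeHom) h Circle.coe_injective

lemma setOf_pow_eq (hN : N ≠ 0) {z w₀ : Circle} (hw₀ : w₀ ^ N = z) :
    {w : Circle | w ^ N = z} =
      (fun k => circleZeta N ^ k * w₀) '' (Finset.range N : Set ℕ) := by
  have hζ := isPrimitiveRoot_circleZeta hN
  ext w
  simp only [Set.mem_ofPred_eq, Set.mem_image, Finset.coe_range, Set.mem_Iio]
  constructor
  · intro hw
    have : NeZero N := ⟨hN⟩
    have h1 : ((w / w₀ : Circle) : ℂ) ^ N = 1 := by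
      rw [← Circle.coe_pow, div_pow, hw, hw₀, div_self', Circle.coe_one]
    obtain ⟨k, hk, hk'⟩ :=
      (hζ.map_of_injective (f := Circle.coeHom) Circle.coe_injective).eq_pow_of_pow_eq_one h1
    refine ⟨k, hk, ?_⟩
    have : circleZeta N ^ k = w / w₀ := Circle.coe_injective (by
      rw [← hk', Circle.coe_pow]; rfl)
    rw [this, div_mul_cancel]
  · rintro ⟨k, -, rfl⟩
    rw [mul_pow, ← pow_mul, mul_comm k, pow_mul, hζ.pow_eq_one, one_pow, one_mul, hw₀]

lemma finsum_pow_eq (hN : N ≠ 0) (G : Circle → ℂ) {z w₀ : Circle} (hw₀ : w₀ ^ N = z) :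
    ∑ᶠ w ∈ {w : Circle | w ^ N = z}, G w =
      ∑ k ∈ Finset.range N, G (circleZeta N ^ k * w₀) := by
  rw [setOf_pow_eq hN hw₀, finsum_mem_image, finsum_mem_coe_finset]
  intro i hi j hj hij
  exact (isPrimitiveRoot_circleZeta hN).pow_inj (Finset.mem_range.1 hi) (Finset.mem_range.1 hj)
    (mul_right_cancel hij)

lemma measurePreserving_circlePow (hN : N ≠ 0) :
    MeasurePreserving (fun z : Circle => z ^ N) circleHaar circleHaar :=
  (powMonoidHom N : Circle →* Circle).measurePreserving (continuous_pow N)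
    (fun z => ⟨_, circleRoot_pow hN z⟩) rfl

/-- The chosen root differs from any other one by a root of unity, so that null sets pull back to
null sets. -/
lemma quasiMeasurePreserving_circleRoot (hN : N ≠ 0) :
    Measure.QuasiMeasurePreserving (circleRoot N) circleHaar circleHaar := by
  refine ⟨measurable_circleRoot N, Measure.AbsolutelyContinuous.mk fun s hs hs0 => ?_⟩
  rw [Measure.map_apply (measurable_circleRoot N) hs,
    ← (measurePreserving_circlePow hN).measure_preimage
      (measurable_circleRoot N hs).nullMeasurableSet]
  -- If `circleRoot N (w ^ N)` lies in `s`, then so does some multiple of `w` by a root of unity.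
  refine measure_mono_null (t := ⋃ k : ℕ, (fun w => circleZeta N ^ k * w) ⁻¹' s) ?_ ?_
  · intro w hw
    have h1 : circleRoot N (w ^ N) ∈ {v : Circle | v ^ N = w ^ N} := circleRoot_pow hN _
    rw [setOf_pow_eq hN (w₀ := w) rfl] at h1
    obtain ⟨k, -, hk⟩ := h1
    refine Set.mem_iUnion.2 ⟨k, ?_⟩
    change circleZeta N ^ k * w ∈ s
    change circleZeta N ^ k * w = _ at hk
    rw [hk]
    exact hw
  · rw [measure_iUnion_null_iff]
    intro k
    rw [measure_preimage_mul, hs0]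

/-- Averaging an integrable function over the fibres of `w ↦ w ^ N` does not change its
integral. -/
lemma integrable_and_integral_rootAverage (hN : N ≠ 0) {G : Circle → ℂ}
    (hG : Integrable G circleHaar) :
    Integrable (fun z => (1 / (N : ℂ)) * ∑ᶠ w ∈ {w : Circle | w ^ N = z}, G w) circleHaar ∧
    ∫ z, (1 / (N : ℂ)) * ∑ᶠ w ∈ {w : Circle | w ^ N = z}, G w ∂circleHaar =
      ∫ z, G z ∂circleHaar := by
  -- `A` is the average over the fibre, and `B = A ∘ (· ^ N)` is an average of rotations of `G`.
  set A : Circle → ℂ := fun z => (1 / (N : ℂ)) * ∑ᶠ w ∈ {w : Circle | w ^ N = z}, G w with hA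
  set B : Circle → ℂ := fun w => (1 / (N : ℂ)) * ∑ k ∈ Finset.range N, G (circleZeta N ^ k * w)
    with hB
  have hAB {w z : Circle} (hw : w ^ N = z) : A z = B w := by
    simp only [hA, hB, finsum_pow_eq hN G hw]
  have hBi : Integrable B circleHaar :=
    (integrable_finsetSum _ fun k _ => hG.comp_mul_left _).const_mul _
  have hA' : A = B ∘ circleRoot N := funext fun z => hAB (circleRoot_pow hN z)
  have hAm : AEStronglyMeasurable A circleHaar := by
    rw [hA']
    exact hBi.1.comp_quasiMeasurePreserving (quasiMeasurePreserving_circleRoot hN)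
  have hp := measurePreserving_circlePow hN
  have hAp : A ∘ (fun z => z ^ N) = B := funext fun w => hAB rfl
  refine ⟨by rw [← hp.integrable_comp hAm, hAp]; exact hBi, ?_⟩
  have h1 : ∫ z, A z ∂circleHaar = ∫ w, B w ∂circleHaar := by
    rw [← hAp, ← hp.map_eq, integral_map hp.aemeasurable (by rwa [hp.map_eq]), hp.map_eq]
    rfl
  rw [h1]
  simp only [hB]
  rw [integral_const_mul, integral_finsetSum _ fun k _ => hG.comp_mul_left _]
  simp only [integral_mul_left_eq_self, Finset.sum_const, Finset.card_range, nsmul_eq_mul]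
  have : (N : ℂ) ≠ 0 := by exact_mod_cast hN
  field_simp

end Roots

/-! ### The Ruelle operator -/

section Ruelle

variable {N : ℕ} {m₀ : Circle → ℂ}

lemma integrable_normSq_mul {m : Circle → ℂ} (hm : MemLp m ∞ circleHaar) {G : Circle → ℂ}
    (hG : Integrable G circleHaar) :
    Integrable (fun w => ((‖m w‖ ^ 2 : ℝ) : ℂ) * G w) circleHaar := by
  have h1 : MemLp (fun w => m w * starRingEnd ℂ (m w)) ∞ circleHaar := hm.star.mul' hm
  refine (hG.mul_of_top_right h1).congr (.of_forall fun w => ?_)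
  simp [Complex.mul_conj, Complex.normSq_eq_norm_sq]

lemma ruelleOp_comp_pow_mul (hN : N ≠ 0) (f g : Circle → ℂ) :
    ruelleOp N m₀ (fun w => f (w ^ N) * g w) = fun z => f z * ruelleOp N m₀ g z := by
  ext z
  rw [ruelleOp, ruelleOp,
    finsum_pow_eq hN (fun w => ((‖m₀ w‖ ^ 2 : ℝ) : ℂ) * (f (w ^ N) * g w)) (circleRoot_pow hN z),
    finsum_pow_eq hN (fun w => ((‖m₀ w‖ ^ 2 : ℝ) : ℂ) * g w) (circleRoot_pow hN z),
    mul_left_comm (f z), Finset.mul_sum _ _ (f z)]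
  congr 1
  refine Finset.sum_congr rfl fun k _ => ?_
  have : (circleZeta N ^ k * circleRoot N z) ^ N = z := by
    rw [mul_pow, circleRoot_pow hN, ← pow_mul, mul_comm k, pow_mul,
      (isPrimitiveRoot_circleZeta hN).pow_eq_one, one_pow, one_mul]
  rw [this]
  ring

lemma integrable_ruelleOp (hN : N ≠ 0) (hm₀ : MemLp m₀ ∞ circleHaar) {G : Circle → ℂ}
    (hG : Integrable G circleHaar) : Integrable (ruelleOp N m₀ G) circleHaar :=
  (integrable_and_integral_rootAverage hN (integrable_normSq_mul hm₀ hG)).1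

lemma integral_ruelleOp (hN : N ≠ 0) (hm₀ : MemLp m₀ ∞ circleHaar) {G : Circle → ℂ}
    (hG : Integrable G circleHaar) :
    ∫ z, ruelleOp N m₀ G z ∂circleHaar = ∫ z, ((‖m₀ z‖ ^ 2 : ℝ) : ℂ) * G z ∂circleHaar :=
  (integrable_and_integral_rootAverage hN (integrable_normSq_mul hm₀ hG)).2

/-- The product `m₀(z) m₀(z ^ N) ⋯ m₀(z ^ (N ^ (i - 1)))`, which is the weight of the `i`-th power
of the operator `ξ ↦ m₀ · ξ(z ^ N)`. -/
noncomputable def filterProd (N : ℕ) (m₀ : Circle → ℂ) (i : ℕ) (z : Circle) : ℂ :=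
  ∏ k ∈ Finset.range i, m₀ (z ^ N ^ k)

lemma filterProd_succ (i : ℕ) (z : Circle) :
    filterProd N m₀ (i + 1) z = filterProd N m₀ i z * m₀ (z ^ N ^ i) :=
  Finset.prod_range_succ _ _

lemma filterProd_succ' (i : ℕ) (z : Circle) :
    filterProd N m₀ (i + 1) z = m₀ z * filterProd N m₀ i (z ^ N) := by
  simp only [filterProd, Finset.prod_range_succ', pow_zero, pow_one, mul_comm (m₀ z), ← pow_mul,
    pow_succ']

lemma memLp_filterProd (hN : N ≠ 0) (hm₀ : MemLp m₀ ∞ circleHaar) (i : ℕ) :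
    MemLp (filterProd N m₀ i) ∞ circleHaar := by
  induction i with
  | zero =>
    have : filterProd N m₀ 0 = fun _ => 1 := by ext z; simp [filterProd]
    rw [this]
    exact memLp_const 1
  | succ i ih =>
    have h1 := (ih.comp_measurePreserving (measurePreserving_circlePow hN)).mul' (r := ∞) hm₀
    exact h1.ae_eq (.of_forall fun z => (filterProd_succ' i z).symm)

/-- By `∫ R g dμ = ∫ |m₀|² g dμ` and `f R(g) = R(f(z ^ N) g)`, each application of `R` contributes
a factor `|m₀|²` and substitutes `z ^ N` in the factors already present. -/
lemma integral_ruelleOp_iterate (hN : N ≠ 0) (hm₀ : MemLp m₀ ∞ circleHaar) (i : ℕ)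
    {G : Circle → ℂ} (hG : Integrable G circleHaar) :
    ∫ z, (ruelleOp N m₀)^[i] G z ∂circleHaar =
      ∫ z, ((‖filterProd N m₀ i z‖ ^ 2 : ℝ) : ℂ) * G z ∂circleHaar := by
  induction i generalizing G with
  | zero => simp [filterProd]
  | succ i ih =>
    rw [Function.iterate_succ_apply, ih (integrable_ruelleOp hN hm₀ hG)]
    have h1 := ruelleOp_comp_pow_mul (m₀ := m₀) hN
      (fun z => ((‖filterProd N m₀ i z‖ ^ 2 : ℝ) : ℂ)) G
    rw [← h1, integral_ruelleOp hN hm₀]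
    · refine integral_congr_ae (.of_forall fun z => ?_)
      simp only [filterProd_succ', norm_mul, mul_pow, Complex.ofReal_mul, mul_assoc]
    · exact integrable_normSq_mul
        ((memLp_filterProd hN hm₀ i).comp_measurePreserving (measurePreserving_circlePow hN)) hG

end Ruelle

/-! ### The laws of the coordinates -/

section Tower

variable {N : ℕ} {m₀ : Circle → ℂ} {h : Circle → ℝ}

lemma weightedHaar_absolutelyContinuous (h : Circle → ℝ) : weightedHaar h ≪ circleHaar :=
  withDensity_absolutelyContinuous _ _

lemma isFiniteMeasure_weightedHaar (hint : Integrable h circleHaar) :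
    IsFiniteMeasure (weightedHaar h) :=
  isFiniteMeasure_withDensity_ofReal hint.2

lemma isFiniteMeasure_sqDensity {Y : Type*} [MeasurableSpace Y] {β : Measure Y}
    [IsFiniteMeasure β] {w : Y → ℂ} (hw : MemLp w ∞ β) : IsFiniteMeasure (sqDensity β w) := by
  refine isFiniteMeasure_withDensity (ne_of_lt ?_)
  have := lintegral_rpow_enorm_lt_top_of_eLpNorm_lt_top two_ne_zero ENNReal.ofNat_ne_top
    (hw.mono_exponent (p := 2) le_top).2
  simpa using this

lemma memLp_top_weightedHaar {m : Circle → ℂ} (hm : MemLp m ∞ circleHaar) :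
    MemLp m ∞ (weightedHaar h) :=
  ⟨hm.1.mono_ac (weightedHaar_absolutelyContinuous h), by
    have := hm.2
    rw [eLpNorm_exponent_top] at this ⊢
    exact (eLpNormEssSup_mono_measure m (weightedHaar_absolutelyContinuous h)).trans_lt this⟩

/-- The law `|m₀(z) m₀(z ^ N) ⋯ m₀(z ^ (N ^ (i - 1)))|² h(z) dμ(z)` which the coordinate
`χ ↦ χ(N ^ (-i))` must have. -/
noncomputable def towerMeasure (N : ℕ) (m₀ : Circle → ℂ) (h : Circle → ℝ) (i : ℕ) :
    Measure Circle :=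
  sqDensity (weightedHaar h) (filterProd N m₀ i)

lemma towerMeasure_zero : towerMeasure N m₀ h 0 = weightedHaar h := by
  have : filterProd N m₀ 0 = fun _ => 1 := by ext z; simp [filterProd]
  rw [towerMeasure, this, sqDensity_one]

lemma isFiniteMeasure_towerMeasure (hN : N ≠ 0) (hm₀ : MemLp m₀ ∞ circleHaar)
    (hint : Integrable h circleHaar) (i : ℕ) : IsFiniteMeasure (towerMeasure N m₀ h i) := by
  have := isFiniteMeasure_weightedHaar hint
  exact isFiniteMeasure_sqDensity (memLp_top_weightedHaar (memLp_filterProd hN hm₀ i))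

lemma towerMeasure_absolutelyContinuous (i : ℕ) : towerMeasure N m₀ h i ≪ circleHaar :=
  (sqDensity_absolutelyContinuous _ _).trans (weightedHaar_absolutelyContinuous h)

lemma towerMeasure_succ (hN : N ≠ 0) (hm₀ : MemLp m₀ ∞ circleHaar) (i : ℕ) :
    towerMeasure N m₀ h (i + 1) =
      sqDensity (towerMeasure N m₀ h i) fun z => m₀ (z ^ N ^ i) := by
  have h1 := (memLp_filterProd hN hm₀ i).1.mono_ac (weightedHaar_absolutelyContinuous h)
  have h2 : AEStronglyMeasurable (fun z => m₀ (z ^ N ^ i)) (weightedHaar h) :=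
    (hm₀.comp_measurePreserving (measurePreserving_circlePow (pow_ne_zero i hN))).1.mono_ac
      (weightedHaar_absolutelyContinuous h)
  rw [towerMeasure, towerMeasure, sqDensity_sqDensity h1 h2]
  congr 1
  ext z
  exact filterProd_succ i z

lemma integral_towerMeasure (hN : N ≠ 0) (hm₀ : MemLp m₀ ∞ circleHaar)
    (hint : Integrable h circleHaar) (hpos : ∀ᵐ z ∂circleHaar, 0 ≤ h z) (i : ℕ)
    (f : Circle → ℂ) :
    ∫ z, f z ∂towerMeasure N m₀ h i =
      ∫ z, ((‖filterProd N m₀ i z‖ ^ 2 : ℝ) : ℂ) * (f z * (h z : ℂ)) ∂circleHaar := by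
  have h1 := (memLp_filterProd hN hm₀ i).1.mono_ac (weightedHaar_absolutelyContinuous h)
  rw [towerMeasure, sqDensity, integral_withDensity_eq_integral_toReal_smul₀
    (aemeasurable_enorm_sq h1) (.of_forall fun z => by simp),
    weightedHaar, integral_withDensity_eq_integral_toReal_smul₀
    hint.1.aemeasurable.ennreal_ofReal (.of_forall fun z => ENNReal.ofReal_lt_top)]
  refine integral_congr_ae ?_
  filter_upwards [hpos] with z hz
  simp only [ENNReal.toReal_ofReal hz, ENNReal.toReal_pow, toReal_enorm, Complex.real_smul]
  ring

lemma measure_circle_ext {α β : Measure Circle} [IsFiniteMeasure α] [IsFiniteMeasure β]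
    (hf : ∀ f : C(Circle, ℂ), ∫ z, f z ∂α = ∫ z, f z ∂β) : α = β := by
  refine ext_of_forall_integral_eq_of_IsFiniteMeasure fun f => ?_
  have h1 := hf ⟨fun z => (f z : ℂ), by fun_prop⟩
  simp only [ContinuousMap.coe_mk, integral_complex_ofReal] at h1
  exact_mod_cast h1

/-- The laws are consistent because `h` is a fixed point of the Ruelle operator. -/
lemma measurePreserving_pow_towerMeasure (hN : N ≠ 0) (hm₀ : MemLp m₀ ∞ circleHaar)
    (hint : Integrable h circleHaar) (hpos : ∀ᵐ z ∂circleHaar, 0 ≤ h z)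
    (hR : ruelleOp N m₀ (fun z => (h z : ℂ)) =ᵐ[circleHaar] fun z => (h z : ℂ)) (i : ℕ) :
    MeasurePreserving (fun z : Circle => z ^ N) (towerMeasure N m₀ h (i + 1))
      (towerMeasure N m₀ h i) := by
  have hpow : Measurable fun z : Circle => z ^ N := (continuous_pow N).measurable
  refine ⟨hpow, ?_⟩
  have := isFiniteMeasure_towerMeasure hN hm₀ hint i
  have := isFiniteMeasure_towerMeasure hN hm₀ hint (i + 1)
  refine measure_circle_ext fun f => ?_
  rw [integral_map hpow.aemeasurable f.continuous.aestronglyMeasurable,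
    integral_towerMeasure hN hm₀ hint hpos, integral_towerMeasure hN hm₀ hint hpos]
  let F : Circle → ℂ := fun z => ((‖filterProd N m₀ i z‖ ^ 2 : ℝ) : ℂ) * f z
  have hF : Integrable (fun z => F (z ^ N) * (h z : ℂ)) circleHaar := by
    have hfh : Integrable (fun z => f (z ^ N) * (h z : ℂ)) circleHaar :=
      hint.ofReal.bdd_mul (c := ‖f‖)
        (f.continuous.comp (continuous_pow N)).aestronglyMeasurable
        (.of_forall fun z => f.norm_coe_le_norm _)
    simpa only [F, mul_assoc, Function.comp_apply] using integrable_normSq_mul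
      ((memLp_filterProd hN hm₀ i).comp_measurePreserving (measurePreserving_circlePow hN)) hfh
  calc ∫ z, ((‖filterProd N m₀ (i + 1) z‖ ^ 2 : ℝ) : ℂ) * (f (z ^ N) * (h z : ℂ)) ∂circleHaar
      = ∫ z, ((‖m₀ z‖ ^ 2 : ℝ) : ℂ) * (F (z ^ N) * (h z : ℂ)) ∂circleHaar := by
        refine integral_congr_ae (.of_forall fun z => ?_)
        simp only [F, filterProd_succ', norm_mul, mul_pow, Complex.ofReal_mul, mul_assoc]
    _ = ∫ z, F z * ruelleOp N m₀ (fun z => (h z : ℂ)) z ∂circleHaar := by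
        rw [← integral_ruelleOp hN hm₀ hF, ruelleOp_comp_pow_mul hN]
    _ = ∫ z, F z * (h z : ℂ) ∂circleHaar := by
        refine integral_congr_ae ?_
        filter_upwards [hR] with z hz
        rw [hz]
    _ = _ := by simp only [F, mul_assoc]

end Tower

/-! ### The compact group `K_N` -/

section Solenoid

/-- The inclusion of `ℤ[1/N]` in `ℚ`. -/
noncomputable def LambdaN.toRat (N : ℕ) : LambdaN N →+* ℚ :=
  (Algebra.adjoin ℤ ({(N : ℚ)⁻¹} : Set ℚ)).val.toRingHom

lemma LambdaN.toRat_injective (N : ℕ) : Function.Injective (LambdaN.toRat N) :=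
  Subtype.val_injective

lemma LambdaN.toRat_invPow (N k : ℕ) : LambdaN.toRat N (invPow N k) = ((N : ℚ)⁻¹) ^ k := rfl

lemma mul_invPow_succ {N : ℕ} (hN : N ≠ 0) (k : ℕ) :
    (N : LambdaN N) * invPow N (k + 1) = invPow N k := by
  apply LambdaN.toRat_injective
  rw [map_mul, map_natCast, LambdaN.toRat_invPow, LambdaN.toRat_invPow, pow_succ']
  have : (N : ℚ) ≠ 0 := by exact_mod_cast hN
  field_simp

/-- Every element of `ℤ[1/N]` is an integer combination of the powers of `1 / N`. -/
lemma LambdaN.induction {N : ℕ} {p : LambdaN N → Prop} (hpow : ∀ k, p (invPow N k)) (h0 : p 0)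
    (hadd : ∀ x y, p x → p y → p (x + y)) (hneg : ∀ x, p x → p (-x)) (x : LambdaN N) : p x := by
  have hx : LambdaN.toRat N x ∈ Subalgebra.toSubmodule
      (Algebra.adjoin ℤ ({(N : ℚ)⁻¹} : Set ℚ)) := Subtype.property x
  rw [Algebra.adjoin_eq_span] at hx
  let q : ℚ → Prop := fun r => ∃ y, LambdaN.toRat N y = r ∧ p y
  have hq : q (LambdaN.toRat N x) := by
    rw [← Submodule.mem_toAddSubgroup, Submodule.span_int_eq_addSubgroupClosure] at hx
    refine AddSubgroup.closure_induction (p := fun r _ => q r) ?_ ?_ ?_ ?_ hx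
    · intro r hr
      obtain ⟨k, rfl⟩ := Submonoid.mem_closure_singleton.1 hr
      exact ⟨_, rfl, hpow k⟩
    · exact ⟨0, map_zero _, h0⟩
    · rintro _ _ _ _ ⟨y, rfl, hy⟩ ⟨z, rfl, hz⟩
      exact ⟨y + z, map_add _ _ _, hadd _ _ hy hz⟩
    · rintro _ _ ⟨y, rfl, hy⟩
      exact ⟨-y, map_neg _ _, hneg _ hy⟩
  obtain ⟨y, hy, hpy⟩ := hq
  rwa [← LambdaN.toRat_injective N hy]

variable {N : ℕ}

lemma KN.map_natCast_mul (χ : KN N) (n : ℕ) (x : LambdaN N) :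
    χ (Multiplicative.ofAdd ((n : LambdaN N) * x)) = χ (Multiplicative.ofAdd x) ^ n := by
  rw [← nsmul_eq_mul, ofAdd_nsmul, map_pow]

lemma KN.coord_succ_pow (hN : N ≠ 0) (k : ℕ) (χ : KN N) :
    χ.coord (k + 1) ^ N = χ.coord k := by
  rw [KN.coord, KN.coord, ← KN.map_natCast_mul, mul_invPow_succ hN]

lemma KN.coord_add_pow (hN : N ≠ 0) (k j : ℕ) (χ : KN N) :
    χ.coord (k + j) ^ N ^ j = χ.coord k := by
  induction j with
  | zero => simp
  | succ j ih => rw [pow_succ', pow_mul, ← add_assoc, KN.coord_succ_pow hN, ih]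

lemma KN.coord_pow_eq_coord_zero (hN : N ≠ 0) (k : ℕ) (χ : KN N) :
    χ.coord k ^ N ^ k = χ.coord 0 := by
  simpa using KN.coord_add_pow hN 0 k χ

lemma KN.coord_pow (k n : ℕ) (χ : KN N) : (χ ^ n).coord k = χ.coord k ^ n :=
  ContinuousMonoidHom.pow_apply χ n _

lemma KN.ext_coord {χ ψ : KN N} (h : ∀ k, χ.coord k = ψ.coord k) : χ = ψ := by
  refine PontryaginDual.ext fun a => ?_
  induction a using Multiplicative.rec with
  | ofAdd x =>
    refine LambdaN.induction (p := fun x => χ (Multiplicative.ofAdd x) =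
      ψ (Multiplicative.ofAdd x)) h ?_ ?_ ?_ x
    · simp
    · intro x y hx hy
      simp [ofAdd_add, hx, hy]
    · intro x hx
      simp [ofAdd_neg, hx]

lemma KN.continuous_coord (k : ℕ) : Continuous (KN.coord k : KN N → Circle) :=
  (continuous_eval_const (F := C(Multiplicative (LambdaN N), Circle)) _).comp
    (ContinuousMonoidHom.isInducing_toContinuousMap _ _).continuous

lemma KN.measurable_coord (k : ℕ) : Measurable (KN.coord k : KN N → Circle) :=
  (KN.continuous_coord k).measurable

/-- The coordinates embed `K_N` as a closed subset of a countable power of the circle. -/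
lemma KN.isClosedEmbedding_coord :
    Topology.IsClosedEmbedding fun (χ : KN N) (k : ℕ) => χ.coord k :=
  Continuous.isClosedEmbedding (continuous_pi KN.continuous_coord)
    fun _ _ h => KN.ext_coord (congrFun h)

/-- A finite measure on `K_N` is determined by the laws of the coordinates, because each
coordinate is a function of the following one. -/
lemma KN.measure_ext (hN : N ≠ 0) {α β : Measure (KN N)} [IsFiniteMeasure α]
    (hαβ : ∀ k, α.map (KN.coord (k + 1)) = β.map (KN.coord (k + 1))) : α = β := by
  have hev (k : ℕ) {s : Set Circle} (hs : MeasurableSet s) :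
      α (KN.coord (k + 1) ⁻¹' s) = β (KN.coord (k + 1) ⁻¹' s) := by
    rw [← Measure.map_apply (KN.measurable_coord _) hs, hαβ,
      Measure.map_apply (KN.measurable_coord _) hs]
  have hlift {k l : ℕ} (hkl : k ≤ l) {s : Set Circle} (hs : MeasurableSet s) :
      ∃ t : Set Circle, MeasurableSet t ∧
        (KN.coord k ⁻¹' s : Set (KN N)) = KN.coord l ⁻¹' t := by
    obtain ⟨j, rfl⟩ := Nat.exists_eq_add_of_le hkl
    refine ⟨(fun z => z ^ N ^ j) ⁻¹' s, (continuous_pow _).measurable hs, ?_⟩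
    ext χ
    simp only [Set.mem_preimage, KN.coord_add_pow hN]
  -- The sets depending on a single coordinate are stable under intersection, since any two of them
  -- depend on a common later coordinate.
  let C : Set (Set (KN N)) := {A | ∃ k, ∃ s, MeasurableSet s ∧ KN.coord (k + 1) ⁻¹' s = A}
  have hgen : (borel (KN N)) = MeasurableSpace.generateFrom C := by
    refine le_antisymm ?_ (MeasurableSpace.generateFrom_le ?_)
    · have h1 := (KN.isClosedEmbedding_coord (N := N)).measurableEmbedding.comap_eq
      change _ = (borel (KN N)) at h1
      rw [← h1, MeasurableSpace.pi, MeasurableSpace.comap_iSup]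
      refine iSup_le fun k => ?_
      rw [MeasurableSpace.comap_comp]
      rintro _ ⟨s, hs, rfl⟩
      obtain ⟨t, ht, hst⟩ := hlift (Nat.le_succ k) hs
      exact MeasurableSpace.measurableSet_generateFrom ⟨k, t, ht, hst.symm⟩
    · rintro _ ⟨k, s, hs, rfl⟩
      exact KN.measurable_coord _ hs
  refine ext_of_generate_finite C hgen ?_ ?_ ?_
  · rintro _ ⟨k, s, hs, rfl⟩ _ ⟨l, t, ht, rfl⟩ -
    obtain ⟨s', hs', hss⟩ := hlift (Nat.succ_le_succ (le_max_left k l)) hs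
    obtain ⟨t', ht', htt⟩ := hlift (Nat.succ_le_succ (le_max_right k l)) ht
    refine ⟨max k l, s' ∩ t', hs'.inter ht', ?_⟩
    rw [Set.preimage_inter]
    exact congrArg₂ _ hss.symm htt.symm
  · rintro _ ⟨k, s, hs, rfl⟩
    exact hev k hs
  · simpa using hev 0 MeasurableSet.univ

lemma KN.apply_invPow_one_mul_pow (hN : N ≠ 0) (χ : KN N) (x : LambdaN N) :
    χ (Multiplicative.ofAdd (invPow N 1 * x)) ^ N = χ (Multiplicative.ofAdd x) := by
  have h0 : invPow N 0 = 1 := LambdaN.toRat_injective N (by simp [LambdaN.toRat_invPow])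
  rw [← KN.map_natCast_mul, ← mul_assoc, mul_invPow_succ hN, h0, one_mul]

/-- The `N`-th power map of `K_N`, which is dual to multiplication by `N` on `ℤ[1/N]` and hence
invertible. -/
noncomputable def KN.powHomeomorph (hN : N ≠ 0) : KN N ≃ₜ KN N where
  toFun χ := χ ^ N
  invFun := PontryaginDual.map
    { toMonoidHom := AddMonoidHom.toMultiplicative (AddMonoidHom.mulLeft (invPow N 1))
      continuous_toFun := continuous_of_discreteTopology }
  left_inv χ := PontryaginDual.ext fun a => by
    refine (ContinuousMonoidHom.pow_apply χ N _).trans ?_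
    exact KN.apply_invPow_one_mul_pow hN χ a.toAdd
  right_inv χ := PontryaginDual.ext fun a => by
    refine (ContinuousMonoidHom.pow_apply _ N a).trans ?_
    exact KN.apply_invPow_one_mul_pow hN χ a.toAdd
  continuous_toFun := continuous_pow N
  continuous_invFun := ContinuousMonoidHom.continuous_toFun _

/-- The character `x ↦ exp (i t x)` of `ℤ[1/N]`. -/
noncomputable def lineChar (N : ℕ) (t : ℝ) : KN N where
  toFun a := Circle.exp (t * (LambdaN.toRat N a.toAdd : ℚ))
  map_one' := by simp
  map_mul' a b := by simp [mul_add, Circle.exp_add]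
  continuous_toFun := continuous_of_discreteTopology

lemma lineChar_coord (t : ℝ) (k : ℕ) : (lineChar N t).coord k = Circle.exp (t / N ^ k) := by
  change Circle.exp (t * (LambdaN.toRat N (invPow N k) : ℚ)) = _
  rw [LambdaN.toRat_invPow]
  push_cast
  rw [inv_pow, div_eq_mul_inv]

lemma continuous_lineChar : Continuous (lineChar N) := by
  refine (KN.isClosedEmbedding_coord (N := N)).isInducing.continuous_iff.2
    (continuous_pi fun k => ?_)
  simp only [Function.comp_def, lineChar_coord]
  fun_prop

/-- A measurable section of the `k`-th coordinate: the character `x ↦ exp (i N ^ k arg(z) x)`,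
whose value at `N ^ (-k)` is `z`. -/
noncomputable def coordSection (N k : ℕ) (z : Circle) : KN N :=
  lineChar N (Complex.arg z * N ^ k)

lemma measurable_coordSection (k : ℕ) : Measurable (coordSection N k) :=
  continuous_lineChar.measurable.comp (measurable_circle_arg.mul_const _)

lemma coord_coordSection (hN : N ≠ 0) (k : ℕ) (z : Circle) : (coordSection N k z).coord k = z := by
  rw [coordSection, lineChar_coord, mul_div_cancel_right₀, Circle.exp_arg]
  exact_mod_cast pow_ne_zero k hN

end Solenoid

/-! ### Existence and uniqueness of the measure -/

section Harmonic

variable {N : ℕ} {m₀ : Circle → ℂ} {h : Circle → ℝ}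

/-- The defining integrals of `ν(m₀, h)` prescribe exactly the laws of the coordinates. -/
lemma isHarmonicMeasure_iff (hN : N ≠ 0) (hm₀ : MemLp m₀ ∞ circleHaar)
    (hint : Integrable h circleHaar) (hpos : ∀ᵐ z ∂circleHaar, 0 ≤ h z) (ν : Measure (KN N)) :
    IsHarmonicMeasure N m₀ h ν ↔
      IsFiniteMeasure ν ∧ ∀ i, ν.map (KN.coord i) = towerMeasure N m₀ h i := by
  have hfh (f : C(Circle, ℂ)) : Integrable (fun z => f z * (h z : ℂ)) circleHaar :=
    hint.ofReal.bdd_mul (c := ‖f‖) f.continuous.aestronglyMeasurable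
      (.of_forall fun z => f.norm_coe_le_norm _)
  have hmap (i : ℕ) (f : C(Circle, ℂ)) :
      ∫ z, f z ∂(ν.map (KN.coord i)) = ∫ χ : KN N, f (χ.coord i) ∂ν :=
    integral_map (KN.measurable_coord i).aemeasurable f.continuous.aestronglyMeasurable
  have hR (i : ℕ) (f : C(Circle, ℂ)) := (integral_towerMeasure hN hm₀ hint hpos i f).trans
    (integral_ruelleOp_iterate hN hm₀ i (hfh f)).symm
  constructor
  · rintro ⟨hfin, hν⟩
    refine ⟨hfin, fun i => ?_⟩
    have := isFiniteMeasure_towerMeasure hN hm₀ hint i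
    exact measure_circle_ext fun f => by rw [hmap, hν, hR]
  · rintro ⟨hfin, hν⟩
    exact ⟨hfin, fun i f => by rw [← hmap, hν, hR]⟩

lemma measurePreserving_pow_iterate_towerMeasure (hN : N ≠ 0) (hm₀ : MemLp m₀ ∞ circleHaar)
    (hint : Integrable h circleHaar) (hpos : ∀ᵐ z ∂circleHaar, 0 ≤ h z)
    (hR : ruelleOp N m₀ (fun z => (h z : ℂ)) =ᵐ[circleHaar] fun z => (h z : ℂ)) (i j : ℕ) :
    MeasurePreserving (fun z : Circle => z ^ N ^ j) (towerMeasure N m₀ h (i + j))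
      (towerMeasure N m₀ h i) := by
  induction j with
  | zero => simpa using! MeasurePreserving.id (towerMeasure N m₀ h i)
  | succ j ih =>
    have := ih.comp (measurePreserving_pow_towerMeasure hN hm₀ hint hpos hR (i + j))
    simpa only [Function.comp_def, ← pow_mul, ← pow_succ', add_assoc] using this

/-- The measures carried by the sections of the coordinates have the required law in all earlier
coordinates; any of their limit points has it in all coordinates. -/
lemma exists_isHarmonicMeasure (hN : N ≠ 0) (hm₀ : MemLp m₀ ∞ circleHaar)
    (hint : Integrable h circleHaar) (hpos : ∀ᵐ z ∂circleHaar, 0 ≤ h z)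
    (hR : ruelleOp N m₀ (fun z => (h z : ℂ)) =ᵐ[circleHaar] fun z => (h z : ℂ)) :
    ∃ ν : Measure (KN N), IsHarmonicMeasure N m₀ h ν := by
  have hfin := isFiniteMeasure_towerMeasure (h := h) hN hm₀ hint
  let P : ℕ → FiniteMeasure (KN N) := fun i =>
    ⟨(towerMeasure N m₀ h i).map (coordSection N i), inferInstance⟩
  let L : ℕ → FiniteMeasure Circle := fun i => ⟨towerMeasure N m₀ h i, hfin i⟩
  have hcoord (k j : ℕ) : (P (k + j)).map (KN.coord k) = L k := by
    apply FiniteMeasure.toMeasure_injective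
    change ((towerMeasure N m₀ h (k + j)).map (coordSection N (k + j))).map (KN.coord k) =
      towerMeasure N m₀ h k
    rw [Measure.map_map (KN.measurable_coord k) (measurable_coordSection _)]
    have hcomp : (KN.coord k ∘ coordSection N (k + j)) = fun z : Circle => z ^ N ^ j := by
      ext z
      rw [Function.comp_apply, ← KN.coord_add_pow hN k j, coord_coordSection hN]
    rw [hcomp]
    exact (measurePreserving_pow_iterate_towerMeasure hN hm₀ hint hpos hR k j).map_eq
  have hmass (i : ℕ) : (P i).mass ≤ (L 0).mass := by
    have h1 := hcoord 0 i
    rw [zero_add] at h1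
    rw [← h1]
    refine le_of_eq ?_
    apply ENNReal.coe_injective
    rw [FiniteMeasure.ennreal_mass, FiniteMeasure.ennreal_mass, FiniteMeasure.toMeasure_map,
      Measure.map_apply (KN.measurable_coord 0) MeasurableSet.univ, Set.preimage_univ]
  obtain ⟨ν, -, hν⟩ := isCompact_iff_ultrafilter_le_nhds.1
    (isCompact_setOfPred_finiteMeasure_le_of_compactSpace (KN N) (L 0).mass)
    (Ultrafilter.map P (hyperfilter ℕ)) (by
      rw [le_principal_iff, Ultrafilter.coe_map, mem_map]
      exact univ_mem' hmass)
  have hlim : Tendsto P (hyperfilter ℕ) (nhds ν) := hν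
  refine ⟨ν, (isHarmonicMeasure_iff hN hm₀ hint hpos _).2 ⟨inferInstance, fun k => ?_⟩⟩
  have h1 := ((FiniteMeasure.continuous_map (KN.continuous_coord (N := N) k)).tendsto ν).comp hlim
  have h2 : Tendsto (fun i => (P i).map (KN.coord k)) (hyperfilter ℕ) (nhds (L k)) := by
    refine tendsto_const_nhds.congr' ?_
    have : ∀ᶠ i in (hyperfilter ℕ : Filter ℕ), k ≤ i :=
      Nat.hyperfilter_le_atTop (eventually_ge_atTop k)
    filter_upwards [this] with i hi
    obtain ⟨j, rfl⟩ := Nat.exists_eq_add_of_le hi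
    exact (hcoord k j).symm
  have h3 := tendsto_nhds_unique h1 h2
  exact congrArg (fun μ : FiniteMeasure Circle => (μ : Measure Circle)) h3

lemma IsHarmonicMeasure.measurePreserving_coord (hN : N ≠ 0) (hm₀ : MemLp m₀ ∞ circleHaar)
    (hint : Integrable h circleHaar) (hpos : ∀ᵐ z ∂circleHaar, 0 ≤ h z) {ν : Measure (KN N)}
    (hν : IsHarmonicMeasure N m₀ h ν) (i : ℕ) :
    MeasurePreserving (KN.coord i) ν (towerMeasure N m₀ h i) :=
  ⟨KN.measurable_coord i, ((isHarmonicMeasure_iff hN hm₀ hint hpos ν).1 hν).2 i⟩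

lemma IsHarmonicMeasure.aestronglyMeasurable_filter (hN : N ≠ 0) (hm₀ : MemLp m₀ ∞ circleHaar)
    (hint : Integrable h circleHaar) (hpos : ∀ᵐ z ∂circleHaar, 0 ≤ h z) {ν : Measure (KN N)}
    (hν : IsHarmonicMeasure N m₀ h ν) :
    AEStronglyMeasurable (fun χ : KN N => m₀ (χ.coord 0)) ν :=
  (hm₀.1.mono_ac (towerMeasure_absolutelyContinuous 0)).comp_measurePreserving
    (hν.measurePreserving_coord hN hm₀ hint hpos 0)

/-- The measure `ν` is quasi-invariant under the `N`-th power map: the map carries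
`|m₀(χ(1))|² dν(χ)` to `ν`. -/
lemma IsHarmonicMeasure.measurePreserving_pow (hN : N ≠ 0) (hm₀ : MemLp m₀ ∞ circleHaar)
    (hint : Integrable h circleHaar) (hpos : ∀ᵐ z ∂circleHaar, 0 ≤ h z)
    {ν : Measure (KN N)} (hν : IsHarmonicMeasure N m₀ h ν) :
    MeasurePreserving (KN.powHomeomorph hN).toMeasurableEquiv
      (sqDensity ν fun χ : KN N => m₀ (χ.coord 0)) ν := by
  have hcoord := hν.measurePreserving_coord hN hm₀ hint hpos
  have := hν.finite
  refine ⟨(KN.powHomeomorph hN).toMeasurableEquiv.measurable, Eq.symm (KN.measure_ext hN ?_)⟩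
  intro k
  rw [Measure.map_map (KN.measurable_coord _) (MeasurableEquiv.measurable _)]
  have hcomp : (KN.coord (k + 1) ∘ (KN.powHomeomorph hN).toMeasurableEquiv) =
      (KN.coord k : KN N → Circle) := by
    ext χ
    exact congrArg _ ((KN.coord_pow (k + 1) N χ).trans (KN.coord_succ_pow hN k χ))
  have hw : (fun χ : KN N => m₀ (χ.coord 0)) = fun χ : KN N => m₀ (χ.coord k ^ N ^ k) := by
    ext χ
    rw [KN.coord_pow_eq_coord_zero hN]
  have hm : AEStronglyMeasurable (fun z => m₀ (z ^ N ^ k)) (ν.map (KN.coord k)) := by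
    rw [(hcoord k).map_eq]
    exact (hm₀.1.comp_measurePreserving
      (measurePreserving_circlePow (pow_ne_zero k hN))).mono_ac
        (towerMeasure_absolutelyContinuous k)
  -- The weight `m₀(z ^ (N ^ k))` is the factor by which the `(k + 1)`-st law differs from the
  -- `k`-th one.
  rw [hcomp, hw, sqDensity_comp_map (w := fun z => m₀ (z ^ N ^ k)) (KN.measurable_coord k) hm,
    (hcoord k).map_eq, (hcoord (k + 1)).map_eq, towerMeasure_succ hN hm₀]

end Harmonic

/-! ### The representation and the power dilation -/

theorem mainTheorem10 (N : ℕ) (hN : 2 ≤ N) (m₀ : Circle → ℂ) (hm₀ : MemLp m₀ ∞ circleHaar)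
    (hns : NonSingular m₀) (h : Circle → ℝ) (hint : Integrable h circleHaar)
    (hpos : ∀ᵐ z ∂circleHaar, 0 ≤ h z)
    (hR : ruelleOp N m₀ (fun z => (h z : ℂ)) =ᵐ[circleHaar] fun z => (h z : ℂ)) :
    -- the measure `ν = ν(m₀, h)` exists and is unique
    (∃! ν : Measure (KN N), IsHarmonicMeasure N m₀ h ν) ∧
    ∀ ν : Measure (KN N), IsHarmonicMeasure N m₀ h ν →
      ∃ (S₀ : Lp ℂ 2 (weightedHaar h) →ₗᵢ[ℂ] Lp ℂ 2 (weightedHaar h))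
        (W : Lp ℂ 2 (weightedHaar h) →ₗᵢ[ℂ] Lp ℂ 2 ν)
        (ρ : RepAN N (Lp ℂ 2 ν)),
        -- the isometry `(S₀ ξ)(z) = m₀(z) ξ(z ^ N)` in `L²(h)`
        IsWeightedComp S₀ m₀ (fun z => z ^ N) ∧
        -- the isometric embedding `(W ξ)(χ) = ξ(χ(1))`
        IsWeightedComp W (fun _ => 1) (fun χ : KN N => χ.coord 0) ∧
        -- the representation `π_ν`: `(π_ν(f) ψ)(χ) = f(χ(1)) ψ(χ)` and
        -- `(π_ν(U) ψ)(χ) = m₀(χ(1)) ψ(χ ^ N)`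
        (∀ f : C(Circle, ℂ),
          IsWeightedComp (ρ.π f) (fun χ : KN N => f (χ.coord 0)) (fun χ => χ)) ∧
        IsWeightedComp ρ.U (fun χ : KN N => m₀ (χ.coord 0)) (fun χ => χ ^ N) ∧
        -- the unitary `π_ν(U)` extends `S₀`
        (∀ ξ, ρ.U (W ξ) = W (S₀ ξ)) ∧
        -- and is a power dilation of `S₀`
        (∀ (n : ℕ) (ξ), ContinuousLinearMap.adjoint W.toContinuousLinearMap (ρ.U^[n] (W ξ)) =
          S₀^[n] ξ) := by
  have hN0 : N ≠ 0 := by omega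
  constructor
  · obtain ⟨ν, hν⟩ := exists_isHarmonicMeasure hN0 hm₀ hint hpos hR
    refine ⟨ν, hν, fun ν' hν' => ?_⟩
    have := hν'.finite
    refine KN.measure_ext hN0 fun k => ?_
    rw [(hν.measurePreserving_coord hN0 hm₀ hint hpos _).map_eq,
      (hν'.measurePreserving_coord hN0 hm₀ hint hpos _).map_eq]
  · intro ν hν
    have hτS : MeasurePreserving (fun z : Circle => z ^ N) (sqDensity (weightedHaar h) m₀)
        (weightedHaar h) := by
      have h1 := measurePreserving_pow_towerMeasure hN0 hm₀ hint hpos hR 0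
      rw [towerMeasure_succ hN0 hm₀, towerMeasure_zero] at h1
      simpa using h1
    have hcoord : MeasurePreserving (KN.coord 0) ν (weightedHaar h) := by
      have h1 := hν.measurePreserving_coord hN0 hm₀ hint hpos 0
      rwa [towerMeasure_zero] at h1
    have hτW : MeasurePreserving (fun χ : KN N => χ.coord 0) (sqDensity ν fun _ => 1)
        (weightedHaar h) := by
      rw [sqDensity_one]
      exact hcoord
    have hτU := hν.measurePreserving_pow hN0 hm₀ hint hpos
    have hmν := hν.aestronglyMeasurable_filter hN0 hm₀ hint hpos
    have hm0 : ∀ᵐ χ : KN N ∂ν, m₀ (χ.coord 0) ≠ 0 :=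
      hcoord.quasiMeasurePreserving.ae ((weightedHaar_absolutelyContinuous h).ae_le hns)
    let S₀ := weightedComp (hm₀.1.mono_ac (weightedHaar_absolutelyContinuous h)) hτS
    let W : Lp ℂ 2 (weightedHaar h) →ₗᵢ[ℂ] Lp ℂ 2 ν :=
      weightedComp aestronglyMeasurable_const hτW
    let U : Lp ℂ 2 ν ≃ₗᵢ[ℂ] Lp ℂ 2 ν := LinearIsometryEquiv.ofSurjective
      (weightedComp hmν hτU) (weightedComp_surjective _ hmν hτU hm0)
    have hS : IsWeightedComp S₀ m₀ (fun z => z ^ N) := isWeightedComp_weightedComp _ hτS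
    have hW : IsWeightedComp W (fun _ => 1) (fun χ : KN N => χ.coord 0) :=
      isWeightedComp_weightedComp _ hτW
    have hU : IsWeightedComp U (fun χ : KN N => m₀ (χ.coord 0)) (fun χ => χ ^ N) :=
      isWeightedComp_weightedComp hmν hτU
    let κ : C(KN N, Circle) := ⟨KN.coord 0, KN.continuous_coord 0⟩
    let ρ : RepAN N (Lp ℂ 2 ν) :=
      { π := mulCompHom ν κ
        U := U
        covariant := fun f x => by
          refine Lp.ext ?_
          filter_upwards [hU.apply_ae_of_ae_eq ((isWeightedComp_mulCompHom κ f).apply_ae x),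
            (isWeightedComp_mulCompHom κ (f.comp (circlePow N))).apply_ae (U x),
            hU.apply_ae x] with χ h1 h2 h3
          rw [h1, h2, h3]
          simp only [κ, ContinuousMap.coe_mk, KN.coord_pow, ContinuousMap.comp_apply, circlePow]
          ring }
    have hUW (ξ) : U (W ξ) = W (S₀ ξ) := by
      refine Lp.ext ?_
      filter_upwards [hU.apply_ae_of_ae_eq (hW.apply_ae ξ),
        hW.apply_ae_of_ae_eq (hS.apply_ae ξ)] with χ h1 h2
      rw [h1, h2, KN.coord_pow]
      ring
    refine ⟨S₀, W, ρ, hS, hW, isWeightedComp_mulCompHom κ, hU, hUW, fun n ξ => ?_⟩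
    -- `U ^ n W = W S₀ ^ n`, and `W* W = 1` because `W` is an isometry.
    have hn : U^[n] (W ξ) = W (S₀^[n] ξ) := ((Function.Semiconj.iterate_right
      (f := W) (ga := S₀) (gb := U) (fun ξ => (hUW ξ).symm) n) ξ).symm
    change ContinuousLinearMap.adjoint W.toContinuousLinearMap (U^[n] (W ξ)) = _
    rw [hn]
    refine ext_inner_left ℂ fun η => ?_
    rw [ContinuousLinearMap.adjoint_inner_right]
    exact W.inner_map_map η _
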